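/- Let $n \ge 0$ and $0<\varepsilon<1$. A function $f\colon\mathbb{R}^n\to\mathbb{R}$ is linear if $f(x+y)=f(x)+f(y)$ and $f(cx)=cf(x)$ for all $x,y\in\mathbb{R}^n$, $c\in\mathbb{R}$. For a probability distribution $\mathcal{D}$ on $\mathbb{R}^n$, a measurable $f$ is $\varepsilon$-far from linear with respect to $\mathcal{D}$ if $\Pr_{x\sim\mathcal{D}}[f(x)\neq g(x)]>\varepsilon$ for every (measurable) linear $g\colon\mathbb{R}^n\to\mathbb{R}$. A sample-based algorithm draws $a$ independent points from $\mathcal{D}$ and, independently, $b$ independent points from the standard Gaussian $\mathcal{N}(0,I)$ on $\mathbb{R}^n$; it is given these $a+b$ points together with the values of the unknown measurable input function $f$ at them, and it then accepts or rejects, possibly using internal randomness. It is a tester for linearity with proximity parameter $\varepsilon$ under $\mathcal{D}$ if it accepts with probability at least $2/3$ every linear $f$, and rejects with probability at least $2/3$ every measurable $f$ that is $\varepsilon$-far from linear with respect to $\mathcal{D}$; it is distribution-free if this holds for every $\mathcal{D}$. **Theorem.** Any sample-based tester for linearity of functions $f\colon\mathbb{R}^n\to\mathbb{R}$ requires $\Omega(n)$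 samples, even when $\mathcal{D}=\mathcal{N}(0,I)$. Precisely: for all $n$ and all $0<\varepsilon<1$, every sample-based algorithm that is a tester for linearity with proximity parameter $\varepsilon$ under $\mathcal{D}=\mathcal{N}(0,I)$ (in particular, every distribution-free one) draws more than $n$ samples in total, $a+b>n$. -/

import Mathlib

open MeasureTheory ProbabilityTheory

noncomputable section

/-- `ℝⁿ` with its Euclidean structure. -/
abbrev RSpace (n : ℕ) : Type := EuclideanSpace ℝ (Fin n)

/-- The standard Gaussian distribution `N(0, I)` on `ℝⁿ`. -/
abbrev gaussianLaw (n : ℕ) : Measure (RSpace n) := stdGaussian (RSpace n)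

/-- The property of being linear (additive and homogeneous). -/
def Linearity (n : ℕ) : Set (RSpace n → ℝ) := {f | IsLinearMap ℝ f}

/-- `f` is `ε`-far from the property `P` with respect to `D`: every measurable `g` with property
`P` satisfies `Pr_{x ∼ D}[f x ≠ g x] > ε`. -/
def IsFar {n : ℕ} (D : Measure (RSpace n)) (ε : ℝ) (P : Set (RSpace n → ℝ))
    (f : RSpace n → ℝ) : Prop :=
  ∀ g : RSpace n → ℝ, Measurable g → g ∈ P → ENNReal.ofReal ε < D {x | f x ≠ g x}

/-- What a sample-based algorithm gets to see: `a` labelled points `(x, f x)` with `x` sampled from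
the unknown distribution, and `b` labelled points with `x` sampled from the standard Gaussian. -/
abbrev LabelledData (n a b : ℕ) : Type :=
  (Fin a → RSpace n × ℝ) × (Fin b → RSpace n × ℝ)

/-- The labelled points that arise from sampled points `x` when the input function is `f`. -/
def label {n a b : ℕ} (f : RSpace n → ℝ)
    (x : (Fin a → RSpace n) × (Fin b → RSpace n)) : LabelledData n a b :=
  (fun i ↦ (x.1 i, f (x.1 i)), fun j ↦ (x.2 j, f (x.2 j)))

/-- The joint law of `a` samples from `D` and `b` samples from `N(0, I)`, all independent. -/
def sampleLaw {n : ℕ} (D : Measure (RSpace n)) (a b : ℕ) :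
    Measure ((Fin a → RSpace n) × (Fin b → RSpace n)) :=
  (Measure.pi fun _ : Fin a ↦ D).prod (Measure.pi fun _ : Fin b ↦ gaussianLaw n)

/-- The law of the labelled data when the input function is `f`. -/
def dataLaw {n : ℕ} (D : Measure (RSpace n)) (a b : ℕ) (f : RSpace n → ℝ) :
    Measure (LabelledData n a b) :=
  (sampleLaw D a b).map (label f)

/-- A (randomized) sample-based algorithm for functions on `ℝⁿ`: it draws `fromD` points from the
unknown distribution and `fromGaussian` points from the standard Gaussian, and, given these points
and the values of the input function there, it answers `true` (accept) or `false` (reject),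
possibly using internal randomness; so its answer is a Markov kernel from the data to `Bool`. -/
structure SampleBasedAlgorithm (n : ℕ) where
  /-- number of samples drawn from the unknown distribution -/
  fromD : ℕ
  /-- number of samples drawn from the standard Gaussian -/
  fromGaussian : ℕ
  /-- the distribution of the answer, given the data -/
  answer : Kernel (LabelledData n fromD fromGaussian) Bool
  /-- an answer is always given -/
  isMarkov : IsMarkovKernel answer

namespace SampleBasedAlgorithm

variable {n : ℕ}

/-- The total number of samples drawn. -/
def sampleCount (A : SampleBasedAlgorithm n) : ℕ := A.fromD + A.fromGaussian

/-- The law of the answer on input function `f`, when the unknown distribution is `D`; the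
probability is over the samples and the internal randomness. -/
def answerLaw (A : SampleBasedAlgorithm n) (D : Measure (RSpace n)) (f : RSpace n → ℝ) :
    Measure Bool :=
  (dataLaw D A.fromD A.fromGaussian f).bind A.answer

/-- `A` is a tester for the property `P` with proximity parameter `ε` when the unknown distribution
is `D`: for measurable input functions, it accepts with probability at least `2/3` those that
satisfy `P`, and rejects with probability at least `2/3` those that are `ε`-far from `P` with
respect to `D`. A distribution-free tester has this property for every probability measure `D`. -/
def IsTester (A : SampleBasedAlgorithm n) (P : Set (RSpace n → ℝ)) (ε : ℝ)
    (D : Measure (RSpace n)) : Prop :=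
  ∀ f : RSpace n → ℝ, Measurable f →
    (f ∈ P → 2 / 3 ≤ A.answerLaw D f {true}) ∧
    (IsFar D ε P f → 2 / 3 ≤ A.answerLaw D f {false})

end SampleBasedAlgorithm

end

/-!
With at most `n` samples, a linear function with a random coefficient vector cannot be told apart
from such a function plus the constant `1`, although the latter is far from linear for every
`ε < 1`, since two distinct affine functions agree on a hyperplane at most, which is a Gaussian null
set (`isFar_affineFn_one`).

Indeed, at most `n` Gaussian samples `xᵢ` are almost surely linearly independent
(`ae_linearIndependent_sumElim`), so some `v` has `⟪v, xᵢ⟫ = 1` for all `i`; on these samples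
`⟪w, ·⟫` takes the same values as `⟪w - v, ·⟫ + 1`. The vector `v` depends on the samples, so the
coefficient vector `w` is averaged over a ball that is large compared to `v`: outside an event of
probability at most `1/6` the norm of `v` is at most some `r`
(`exists_unitInterpolable_compl_le`), and translation invariance of Lebesgue measure bounds the
integral over `‖w‖ ≤ R` of the acceptance probability on `⟪w, ·⟫` by the integral over
`‖w‖ ≤ R + r` of the one on `⟪w, ·⟫ + 1`, up to the contribution of the exceptional event
(`lintegral_answerLaw_le`). For a tester this gives `2/3 ≤ (1 + r/R)ⁿ / 3 + 1/6`, which is false for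
large `R`.
-/

open scoped RealInnerProductSpace ENNReal

/-! ### Hyperplanes and linear independence under the Gaussian law -/

/-- Affine hyperplanes are null: the law of `⟪u, ·⟫` is a nondegenerate real Gaussian. -/
lemma gaussianLaw_hyperplane {n : ℕ} {u : RSpace n} (hu : u ≠ 0) (c : ℝ) :
    gaussianLaw n {x | ⟪u, x⟫ = c} = 0 := by
  have hmap := IsGaussian.map_eq_gaussianReal (μ := gaussianLaw n) (innerSL ℝ u)
  rw [variance_dual_stdGaussian, innerSL_apply_norm] at hmap
  have hv : (‖u‖ ^ 2).toNNReal ≠ 0 := by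
    rw [Ne, Real.toNNReal_eq_zero, not_le]
    exact pow_pos (norm_pos_iff.2 hu) 2
  have := nullSingletonClass_gaussianReal
    (μ := (gaussianLaw n)[fun x ↦ innerSL ℝ u x]) hv
  have h0 : (gaussianLaw n).map (innerSL ℝ u) {c} = 0 := by
    rw [hmap]
    exact measure_singleton c
  rwa [Measure.map_apply (by fun_prop) (measurableSet_singleton c)] at h0

lemma gaussianLaw_submodule {n : ℕ} {S : Submodule ℝ (RSpace n)} (hS : S ≠ ⊤) :
    gaussianLaw n S = 0 := by
  obtain ⟨u, huS, hu⟩ := (Submodule.ne_bot_iff _).1 (mt Submodule.orthogonal_eq_bot_iff.1 hS)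
  exact measure_mono_null
    (fun x hx ↦ Submodule.inner_left_of_mem_orthogonal hx huS) (gaussianLaw_hyperplane hu 0)

lemma ae_linearIndependent_fin {n m : ℕ} (hm : m ≤ n) :
    ∀ᵐ x ∂(Measure.pi fun _ : Fin m ↦ gaussianLaw n), LinearIndependent ℝ x := by
  induction m with
  | zero => exact .of_forall fun x ↦ linearIndependent_empty_type
  | succ m ih =>
    have hpres := (measurePreserving_piFinSuccAbove (fun _ : Fin (m + 1) ↦ gaussianLaw n) 0).symm
    have hmeas : MeasurableSet {p : RSpace n × (Fin m → RSpace n) | LinearIndependent ℝ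
        ((MeasurableEquiv.piFinSuccAbove (fun _ : Fin (m + 1) ↦ RSpace n) 0).symm p)} :=
      (MeasurableEquiv.measurable _) (isOpen_setOfPred_linearIndependent (𝕜 := ℝ)).measurableSet
    rw [← hpres.map_eq, (MeasurableEquiv.measurableEmbedding _).ae_map_iff]
    refine (Measure.ae_prod_iff_ae_ae hmeas).2 ((Measure.ae_ae_comm hmeas).2 ?_)
    filter_upwards [ih (by omega)] with y hy
    have hspan : Submodule.span ℝ (Set.range y) ≠ ⊤ := by
      intro h
      have h1 := finrank_span_eq_card hy
      rw [h, finrank_top, finrank_euclideanSpace_fin, Fintype.card_fin] at h1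
      omega
    filter_upwards [compl_mem_ae_iff.2 (gaussianLaw_submodule hspan)] with x hx
    have hcons : (MeasurableEquiv.piFinSuccAbove (fun _ : Fin (m + 1) ↦ RSpace n) 0).symm (x, y) =
        Fin.cons x y := Fin.insertNth_zero' x y
    have hli := linearIndependent_finCons.2 ⟨hy, hx⟩
    rwa [← hcons] at hli

/-- At most `n` Gaussian samples, in two batches, are almost surely linearly independent. -/
lemma ae_linearIndependent_sumElim {n a b : ℕ} (h : a + b ≤ n) :
    ∀ᵐ x ∂(sampleLaw (gaussianLaw n) a b), LinearIndependent ℝ (Sum.elim x.1 x.2) := by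
  have h1 := ae_linearIndependent_fin h
  have hp := measurePreserving_piCongrLeft (fun _ : Fin a ⊕ Fin b ↦ gaussianLaw n)
    finSumFinEquiv.symm
  have hq := measurePreserving_sumPiEquivProdPi (fun _ : Fin a ⊕ Fin b ↦ gaussianLaw n)
  rw [sampleLaw, ← hq.map_eq, (MeasurableEquiv.measurableEmbedding _).ae_map_iff,
    ← hp.map_eq, (MeasurableEquiv.measurableEmbedding _).ae_map_iff]
  filter_upwards [h1] with x hx
  have := hx.comp finSumFinEquiv finSumFinEquiv.injective
  convert this using 1
  have hval (s : Fin a ⊕ Fin b) :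
      MeasurableEquiv.piCongrLeft (fun _ ↦ RSpace n) finSumFinEquiv.symm x s =
        x (finSumFinEquiv s) := by
    simpa using MeasurableEquiv.piCongrLeft_apply_apply finSumFinEquiv.symm
      (β := fun _ ↦ RSpace n) x (finSumFinEquiv s)
  funext s
  cases s <;> exact hval _

/-- Some vector has the same prescribed inner product with all members of a linearly independent
family: extend the family to a basis and represent the resulting functional. -/
lemma LinearIndependent.exists_inner_eq {n : ℕ} {ι : Type*} {x : ι → RSpace n}
    (hx : LinearIndependent ℝ x) (c : ℝ) : ∃ v : RSpace n, ∀ i, ⟪v, x i⟫ = c := by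
  have hs := hx.linearIndepOn_id
  let B := Module.Basis.extend hs
  let L : RSpace n →ₗ[ℝ] ℝ := B.constr ℝ fun _ ↦ c
  refine ⟨(InnerProductSpace.toDual ℝ _).symm L.toContinuousLinearMap, fun i ↦ ?_⟩
  rw [InnerProductSpace.toDual_symm_apply]
  have hB : B ⟨x i, hs.subset_extend _ ⟨i, rfl⟩⟩ = x i := Module.Basis.extend_apply_self hs _
  rw [← hB]
  exact B.constr_basis ℝ _ _

/-! ### Affine functions as hard instances -/

/-- The affine function `x ↦ ⟪w, x⟫ + c`. It is linear for `c = 0`; for `c ≠ 0` it agrees with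
any given linear function only on a Gaussian null set. -/
noncomputable def affineFn {n : ℕ} (w : RSpace n) (c : ℝ) (x : RSpace n) : ℝ := ⟪w, x⟫ + c

lemma measurable_affineFn {n : ℕ} (w : RSpace n) (c : ℝ) : Measurable (affineFn w c) := by
  unfold affineFn
  fun_prop

lemma affineFn_zero_mem_linearity {n : ℕ} (w : RSpace n) : affineFn w 0 ∈ Linearity n :=
  ⟨fun x y ↦ by simp [affineFn, inner_add_right], fun c x ↦ by simp [affineFn, inner_smul_right]⟩

lemma isFar_affineFn_one {n : ℕ} {ε : ℝ} (hε : ε < 1) (w : RSpace n) :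
    IsFar (gaussianLaw n) ε (Linearity n) (affineFn w 1) := by
  intro g hg hlin
  let L : RSpace n →ₗ[ℝ] ℝ := hlin.mk' g
  let z : RSpace n := (InnerProductSpace.toDual ℝ _).symm L.toContinuousLinearMap
  have hz (x : RSpace n) : ⟪z, x⟫ = g x := InnerProductSpace.toDual_symm_apply ..
  have hset : {x | affineFn w 1 x ≠ g x} = {x | ⟪z - w, x⟫ = 1}ᶜ := by
    ext x
    simp only [affineFn, ← hz, inner_sub_left, Set.mem_compl_iff, Set.mem_ofPred_eq, ne_eq]
    rw [sub_eq_iff_eq_add', eq_comm]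
  have hnull : gaussianLaw n {x | ⟪z - w, x⟫ = 1} = 0 := by
    by_cases h : z - w = 0
    · simp [h]
    · exact gaussianLaw_hyperplane h 1
  rw [hset, measure_compl ((isClosed_eq (by fun_prop) (by fun_prop)).measurableSet)
    (by simp [hnull]), hnull, measure_univ, tsub_zero]
  simpa using hε

lemma measurable_label_affineFn {n a b : ℕ} (c : ℝ) :
    Measurable fun p : RSpace n × ((Fin a → RSpace n) × (Fin b → RSpace n)) ↦
      label (affineFn p.1 c) p.2 := by
  unfold label affineFn
  fun_prop

lemma SampleBasedAlgorithm.answerLaw_apply {n : ℕ} (A : SampleBasedAlgorithm n)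
    (D : Measure (RSpace n)) {f : RSpace n → ℝ} (hf : Measurable f) (s : Set Bool) :
    A.answerLaw D f s =
      ∫⁻ x, A.answer (label f x) s ∂(sampleLaw D A.fromD A.fromGaussian) := by
  have hl : Measurable (label (a := A.fromD) (b := A.fromGaussian) f) := by
    unfold label
    fun_prop
  rw [answerLaw, Measure.bind_apply (MeasurableSet.of_discrete) A.answer.aemeasurable, dataLaw,
    lintegral_map (A.answer.measurable_coe MeasurableSet.of_discrete) hl]

lemma SampleBasedAlgorithm.answerLaw_univ_le {n : ℕ} (A : SampleBasedAlgorithm n)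
    {f : RSpace n → ℝ} (hf : Measurable f) : A.answerLaw (gaussianLaw n) f Set.univ ≤ 1 := by
  have := A.isMarkov
  rw [A.answerLaw_apply _ hf]
  simp only [measure_univ, lintegral_const, sampleLaw, mul_one, le_refl]

/-! ### Coupling linear and affine functions by a shift -/

/-- The samples at which some linear functional of norm at most `r` is constantly `1`. -/
def unitInterpolable (n a b : ℕ) (r : ℝ) : Set ((Fin a → RSpace n) × (Fin b → RSpace n)) :=
  {x | ∃ v : RSpace n, ‖v‖ ≤ r ∧ (∀ i, ⟪v, x.1 i⟫ = 1) ∧ ∀ j, ⟪v, x.2 j⟫ = 1}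

/-- The set is closed. Closedness comes from the compactness of the ball that `v` ranges over. -/
lemma measurableSet_unitInterpolable (n a b : ℕ) (r : ℝ) :
    MeasurableSet (unitInterpolable n a b r) := by
  let C : Set (Metric.closedBall (0 : RSpace n) r × ((Fin a → RSpace n) × (Fin b → RSpace n))) :=
    {p | (∀ i, ⟪(p.1 : RSpace n), p.2.1 i⟫ = 1) ∧ ∀ j, ⟪(p.1 : RSpace n), p.2.2 j⟫ = 1}
  have hC : IsClosed C := by
    refine IsClosed.and ?_ ?_ <;>
    · simp only [Set.ofPred_forall]
      exact isClosed_iInter fun i ↦ isClosed_eq (by fun_prop) (by fun_prop)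
  have := isClosedMap_snd_of_compactSpace C hC
  convert this.measurableSet using 1
  ext x
  simp [unitInterpolable, C, and_left_comm]

/-- For a large radius, the complement of `unitInterpolable` has small probability. -/
lemma exists_unitInterpolable_compl_le {n a b : ℕ} (h : a + b ≤ n) {δ : ℝ≥0∞} (hδ : 0 < δ) :
    ∃ r : ℝ, 0 < r ∧ sampleLaw (gaussianLaw n) a b (unitInterpolable n a b r)ᶜ ≤ δ := by
  have : IsProbabilityMeasure (sampleLaw (gaussianLaw n) a b) := by
    unfold sampleLaw; infer_instance
  have hanti : Antitone fun k : ℕ ↦ (unitInterpolable n a b k)ᶜ := by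
    intro k l hkl
    refine Set.compl_subset_compl.2 ?_
    rintro x ⟨v, hv, hx⟩
    exact ⟨v, hv.trans (by exact_mod_cast hkl), hx⟩
  have hlim := tendsto_measure_iInter_atTop (μ := sampleLaw (gaussianLaw n) a b)
    (fun k : ℕ ↦ (measurableSet_unitInterpolable n a b k).compl.nullMeasurableSet) hanti
    ⟨0, measure_ne_top _ _⟩
  have hzero : sampleLaw (gaussianLaw n) a b (⋂ k : ℕ, (unitInterpolable n a b k)ᶜ) = 0 := by
    refine measure_mono_null ?_ (ae_iff.1 (ae_linearIndependent_sumElim h))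
    intro x hx hli
    obtain ⟨v, hv⟩ := hli.exists_inner_eq 1
    obtain ⟨k, hk⟩ := exists_nat_ge ‖v‖
    exact Set.mem_iInter.1 hx k ⟨v, hk, fun i ↦ hv (.inl i), fun j ↦ hv (.inr j)⟩
  rw [hzero] at hlim
  obtain ⟨k, hk, hk0⟩ :=
    ((hlim.eventually (ge_mem_nhds hδ)).and (Filter.eventually_gt_atTop 0)).exists
  exact ⟨k, by exact_mod_cast hk0, hk⟩

/-- On samples where `v` interpolates the constant `1`, the data of `⟪w, ·⟫` and of
`⟪w - v, ·⟫ + 1` coincide, so translating `w` by `v` compares the two integrals. -/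
lemma lintegral_label_le_of_mem {n a b : ℕ} {r : ℝ}
    {x : (Fin a → RSpace n) × (Fin b → RSpace n)} (hx : x ∈ unitInterpolable n a b r)
    (F : LabelledData n a b → ℝ≥0∞) (R : ℝ) :
    ∫⁻ w in Metric.closedBall 0 R, F (label (affineFn w 0) x) ≤
      ∫⁻ w in Metric.closedBall 0 (R + r), F (label (affineFn w 1) x) := by
  obtain ⟨v, hv, h1, h2⟩ := hx
  have hlab (w : RSpace n) : label (affineFn (w + v) 0) x = label (affineFn w 1) x := by
    simp [label, affineFn, inner_add_left, h1, h2]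
  rw [← lintegral_indicator measurableSet_closedBall,
    ← lintegral_indicator measurableSet_closedBall,
    ← lintegral_add_right_eq_self
      ((Metric.closedBall 0 R).indicator fun w ↦ F (label (affineFn w 0) x)) v]
  refine lintegral_mono fun w ↦ ?_
  by_cases hw : w + v ∈ Metric.closedBall (0 : RSpace n) R
  swap
  · simp [Set.indicator_of_notMem hw]
  have hw' : w ∈ Metric.closedBall (0 : RSpace n) (R + r) := by
    rw [mem_closedBall_zero_iff] at hw ⊢
    calc ‖w‖ = ‖(w + v) - v‖ := by simp
      _ ≤ ‖w + v‖ + ‖v‖ := norm_sub_le _ _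
      _ ≤ R + r := by gcongr
  rw [Set.indicator_of_mem hw, Set.indicator_of_mem hw', hlab]

/-- Averaged comparison of the acceptance probabilities on linear and on affine functions. -/
lemma lintegral_answerLaw_le {n : ℕ} (A : SampleBasedAlgorithm n) (R r : ℝ) (s : Set Bool) :
    ∫⁻ w in Metric.closedBall 0 R, A.answerLaw (gaussianLaw n) (affineFn w 0) s ≤
      (∫⁻ w in Metric.closedBall 0 (R + r), A.answerLaw (gaussianLaw n) (affineFn w 1) s) +
      sampleLaw (gaussianLaw n) A.fromD A.fromGaussian
        (unitInterpolable n A.fromD A.fromGaussian r)ᶜ *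
          volume (Metric.closedBall (0 : RSpace n) R) := by
  have := A.isMarkov
  have : IsProbabilityMeasure (sampleLaw (gaussianLaw n) A.fromD A.fromGaussian) := by
    unfold sampleLaw; infer_instance
  have hmeas (c : ℝ) : Measurable fun p : RSpace n × _ ↦ A.answer (label (affineFn p.1 c) p.2) s :=
    (A.answer.measurable_coe MeasurableSet.of_discrete).comp (measurable_label_affineFn c)
  simp only [A.answerLaw_apply _ (measurable_affineFn _ _)]
  have hswap (c R : ℝ) := lintegral_lintegral_swap
    (f := fun w x ↦ A.answer (label (affineFn w c) x) s)
    (μ := volume.restrict (Metric.closedBall 0 R))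
    (ν := sampleLaw (gaussianLaw n) A.fromD A.fromGaussian) (hmeas c).aemeasurable
  rw [hswap, hswap,
    ← lintegral_add_compl _ (measurableSet_unitInterpolable n A.fromD A.fromGaussian r)]
  refine add_le_add ?_ ?_
  · exact (setLIntegral_mono' (measurableSet_unitInterpolable _ _ _ _) fun x hx ↦
      lintegral_label_le_of_mem hx (fun d ↦ A.answer d s) R).trans (setLIntegral_le_lintegral _ _)
  · calc _ ≤ ∫⁻ x in (unitInterpolable n A.fromD A.fromGaussian r)ᶜ,
          volume (Metric.closedBall (0 : RSpace n) R)
          ∂(sampleLaw (gaussianLaw n) A.fromD A.fromGaussian) := by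
          refine lintegral_mono fun x ↦ ?_
          calc _ ≤ ∫⁻ w in Metric.closedBall (0 : RSpace n) R, 1 :=
                lintegral_mono fun w ↦ prob_le_one
            _ = _ := by simp
      _ = _ := by rw [setLIntegral_const, mul_comm]

/-! ### The lower bound -/

theorem theorem3 (n : ℕ) (ε : ℝ) (hε₀ : 0 < ε) (hε₁ : ε < 1) (A : SampleBasedAlgorithm n)
    (hA : A.IsTester (Linearity n) ε (gaussianLaw n)) :
    n < A.sampleCount := by
  by_contra! hn
  have hacc (w : RSpace n) : 2 / 3 ≤ A.answerLaw (gaussianLaw n) (affineFn w 0) {true} :=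
    (hA _ (measurable_affineFn w 0)).1 (affineFn_zero_mem_linearity w)
  have hrej (w : RSpace n) : A.answerLaw (gaussianLaw n) (affineFn w 1) {true} ≤ 1 / 3 := by
    have h1 := (hA _ (measurable_affineFn w 1)).2 (isFar_affineFn_one hε₁ w)
    have h2 := A.answerLaw_univ_le (measurable_affineFn w 1)
    rw [show (Set.univ : Set Bool) = {true} ∪ {false} by ext b; cases b <;> simp,
      measure_union (by simp) (MeasurableSet.of_discrete)] at h2
    have h3 : A.answerLaw (gaussianLaw n) (affineFn w 1) {true} + 2 / 3 ≤ 1 / 3 + 2 / 3 := by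
      refine (add_le_add_right h1 _).trans (h2.trans_eq ?_)
      rw [ENNReal.div_add_div_same, show (1 : ℝ≥0∞) + 2 = 3 by norm_num,
        ENNReal.div_self (by simp) (by simp)]
    exact (ENNReal.add_le_add_iff_right (ENNReal.div_ne_top (by simp) (by simp))).1 h3
  obtain ⟨r, hr, hG⟩ := exists_unitInterpolable_compl_le (n := n) hn
    (δ := ENNReal.ofReal (1 / 6)) (by simp)
  -- Radii `R = r / t` and `R + r` have volume ratio `(1 + t) ^ n`, close to `1` for small `t`.
  obtain ⟨t, ht, ht0⟩ : ∃ t : ℝ, (1 + t) ^ n < 3 / 2 ∧ 0 < t := by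
    have hc : Filter.Tendsto (fun t : ℝ ↦ (1 + t) ^ n) (nhdsWithin 0 (Set.Ioi 0)) (nhds 1) := by
      have : Continuous fun t : ℝ ↦ (1 + t) ^ n := by fun_prop
      simpa using (this.tendsto 0).mono_left nhdsWithin_le_nhds
    exact ((hc.eventually (gt_mem_nhds (by norm_num))).and self_mem_nhdsWithin).exists
  have hR : 0 < r / t := by positivity
  set V := volume (Metric.closedBall (0 : RSpace n) (r / t)) with hV
  have hV0 : V ≠ 0 := (Metric.measure_closedBall_pos volume _ hR).ne'
  have hVt : V ≠ ∞ := measure_closedBall_lt_top.ne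
  have hvol : volume (Metric.closedBall (0 : RSpace n) (r / t + r)) =
      ENNReal.ofReal ((1 + t) ^ n) * V := by
    rw [show r / t + r = (1 + t) * (r / t) by field_simp,
      Measure.addHaar_closedBall_mul _ _ (by positivity) hR.le, finrank_euclideanSpace_fin]
  have hmain := lintegral_answerLaw_le A (r / t) r {true}
  have hle : 2 / 3 * V ≤ 1 / 3 * (ENNReal.ofReal ((1 + t) ^ n) * V) + ENNReal.ofReal (1 / 6) * V :=
    calc 2 / 3 * V = ∫⁻ w in Metric.closedBall (0 : RSpace n) (r / t), 2 / 3 := by simp [hV]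
      _ ≤ _ := lintegral_mono fun w ↦ hacc w
      _ ≤ _ := hmain
      _ ≤ (∫⁻ w in Metric.closedBall (0 : RSpace n) (r / t + r), 1 / 3) +
          ENNReal.ofReal (1 / 6) * V := by
        gcongr with w
        exact hrej w
      _ = _ := by rw [setLIntegral_const, hvol]
  rw [← mul_assoc, ← add_mul, ENNReal.mul_le_mul_iff_left hV0 hVt] at hle
  have hreal : (2 / 3 : ℝ) ≤ 1 / 3 * (1 + t) ^ n + 1 / 6 := by
    have h23 : (2 / 3 : ℝ≥0∞) = ENNReal.ofReal (2 / 3) := by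
      rw [ENNReal.ofReal_div_of_pos (by norm_num)]; simp
    have h13 : (1 / 3 : ℝ≥0∞) = ENNReal.ofReal (1 / 3) := by
      rw [ENNReal.ofReal_div_of_pos (by norm_num)]; simp
    rw [h23, h13, ← ENNReal.ofReal_mul (by norm_num),
      ← ENNReal.ofReal_add (by positivity) (by norm_num)] at hle
    exact (ENNReal.ofReal_le_ofReal_iff (by positivity)).1 hle
  linarith
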